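/- Let $m,n\ge 0$ be integers and let $T\in M_m(\mathbb C)\otimes M_n(\mathbb C)$ be separable, i.e. $T=\sum_{i=1}^{k}A_i\otimes C_i$ for finitely many positive semidefinite matrices $A_i\in M_m(\mathbb C)$, $C_i\in M_n(\mathbb C)$ (no trace normalization is required; density matrices are the case $\operatorname{tr}T=1$). Let $T_B=\operatorname{tr}_A T\in M_n(\mathbb C)$ be the marginal of $T$ obtained by tracing out the first factor, and suppose that $T$ satisfies the marginal rank condition $\operatorname{rank}T=\operatorname{rank}T_B$. For a unit vector $x\in\mathbb C^m$ let $P_x$ denote the orthogonal projection onto $\mathbb C x$. Then $T$ admits a decomposition $$T=\sum_{\gamma=1}^{p}P_{x_\gamma}\otimes B_\gamma ,$$ where $p\ge 0$, $B_1,\dots,B_p\in M_n(\mathbb C)$ are nonzero positive semidefinite matrices whose images are independent subspaces of $\mathbb C^n$ (their sum is direct), and $x_1,\dots,x_p\in\mathbb C^m$ are unit vectors such that $P_{x_1},\dots,P_{x_p}$ are distinct. This decomposition is unique up to the order of the summands: if $T=\sum_{\delta=1}^{q}P_{y_\delta}\otimes C_\delta$ is another decomposition with the same properties, then $q=p$ and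 there is a bijection $\sigma$ of $\{1,\dots,p\}$ such that $P_{x_\gamma}=P_{y_{\sigma(\gamma)}}$ and $B_\gamma=C_{\sigma(\gamma)}$ for every $\gamma$. -/

import Mathlib

open scoped Kronecker ComplexOrder

/-!
Throughout, `M_m ⊗ M_n` is identified, by the Kronecker product, with the complex matrices
whose rows and columns are indexed by `Fin m × Fin n`.
-/

namespace SepState

/-- The rank-one matrix `P_x = x x*`, with entries `x i * conj (x j)`. For a unit vector `x` it is
the orthogonal projection onto `ℂ x`, see `toEuclideanLin_proj`. -/
def proj {m : ℕ} (x : EuclideanSpace ℂ (Fin m)) : Matrix (Fin m) (Fin m) ℂ :=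
  Matrix.of fun i j => x i * star (x j)

theorem toEuclideanLin_proj {m : ℕ} (x : EuclideanSpace ℂ (Fin m)) (hx : ‖x‖ = 1) :
    Matrix.toEuclideanLin (proj x) = ((ℂ ∙ x).starProjection : _ →ₗ[ℂ] _) := by
  ext v i
  rw [ContinuousLinearMap.coe_coe, Submodule.starProjection_unit_singleton ℂ hx]
  simp [proj, Matrix.mulVec, dotProduct, PiLp.inner_apply, Finset.sum_mul]
  exact Finset.sum_congr rfl fun j _ => by ring

/-- The partial trace over the first tensor factor: `T_B = tr_A T`, i.e. `∑ i, T_{ii}` when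
`T = ∑ i j, E_{ij} ⊗ T_{ij}`. -/
def marginalB {m n : ℕ} (T : Matrix (Fin m × Fin n) (Fin m × Fin n) ℂ) :
    Matrix (Fin n) (Fin n) ℂ :=
  Matrix.of fun k l => ∑ i : Fin m, T (i, k) (i, l)

theorem marginalB_kronecker {m n : ℕ} (A : Matrix (Fin m) (Fin m) ℂ)
    (B : Matrix (Fin n) (Fin n) ℂ) : marginalB (A ⊗ₖ B) = A.trace • B := by
  ext k l
  simp [marginalB, Matrix.trace, Finset.sum_mul]

/-- `T` is separable: a finite sum of tensor products of positive semidefinite matrices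
(no normalization of the trace is imposed). -/
def IsSeparable {m n : ℕ} (T : Matrix (Fin m × Fin n) (Fin m × Fin n) ℂ) : Prop :=
  ∃ (p : ℕ) (A : Fin p → Matrix (Fin m) (Fin m) ℂ) (B : Fin p → Matrix (Fin n) (Fin n) ℂ),
    (∀ γ, (A γ).PosSemidef) ∧ (∀ γ, (B γ).PosSemidef) ∧ T = ∑ γ, A γ ⊗ₖ B γ

/-- The marginal rank condition (with respect to the second factor): `rank T = rank T_B`. -/
def MarginalRank {m n : ℕ} (T : Matrix (Fin m × Fin n) (Fin m × Fin n) ℂ) : Prop :=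
  T.rank = (marginalB T).rank

/-- `T = ∑ γ, P_{x_γ} ⊗ B_γ` with unit vectors `x_γ` whose projections `P_{x_γ}` are distinct, and
nonzero positive semidefinite matrices `B_γ` with independent images. -/
structure IsDecomposition {m n p : ℕ} (T : Matrix (Fin m × Fin n) (Fin m × Fin n) ℂ)
    (x : Fin p → EuclideanSpace ℂ (Fin m)) (B : Fin p → Matrix (Fin n) (Fin n) ℂ) : Prop where
  norm_eq_one : ∀ γ, ‖x γ‖ = 1
  proj_distinct : ∀ γ δ, γ ≠ δ → proj (x γ) ≠ proj (x δ)
  posSemidef : ∀ γ, (B γ).PosSemidef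
  ne_zero : ∀ γ, B γ ≠ 0
  independent : iSupIndep fun γ => LinearMap.range (B γ).mulVecLin
  eq_sum : T = ∑ γ, proj (x γ) ⊗ₖ B γ

end SepState

/-! Write `T` as a sum of projections onto product vectors `x_i ⊗ y_i`, up to scaling, with unit
`x_i`. The rank condition says that the `x_i ⊗ y_i` and the `y_i` span spaces of equal dimension.
For a functional `φ` with all `φ (x_i) ≠ 0`, `φ ⊗ 1` sends `x_i ⊗ y_i` to `φ (x_i) y_i`, so by
dimension both families have the same relations. Hence relations among the `y_i` survive
multiplication by `x_i(j) / φ (x_i)` (`sum_coord_div_smul_eq_zero`). Interpolating in these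
coordinates splits relations along classes of equal `P_{x_i}` (`sum_fiber_smul_eq_zero`), so
grouping by class gives independent images. For uniqueness, compress the blocks of `T` by matrices
separating the images (`exists_match`). -/

namespace SepState

/-! ### Uniqueness -/

/-- Matrices with independent images are separated by matrices acting as the identity on one image
and as zero on the others. -/
theorem exists_mul_eq_ite {n ι : Type*} [Fintype n] [DecidableEq n] [DecidableEq ι]
    {B : ι → Matrix n n ℂ} (h : iSupIndep fun γ => LinearMap.range (B γ).mulVecLin) :
    ∃ E : ι → Matrix n n ℂ, ∀ γ δ, E γ * B δ = if δ = γ then B δ else 0 := by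
  have key : ∀ γ, ∃ E : Matrix n n ℂ, ∀ δ, E * B δ = if δ = γ then B δ else 0 := by
    intro γ
    -- The complement is chosen to contain all the other images.
    obtain ⟨c, hle, hc⟩ := (h γ).symm.exists_isCompl
    refine ⟨LinearMap.toMatrix' (Submodule.projection _ _ hc.symm), fun δ => ?_⟩
    apply Matrix.toLin'.injective
    refine LinearMap.ext fun v => ?_
    simp only [LinearMap.comp_apply, Matrix.toLin'_mul, Matrix.toLin'_toMatrix']
    split_ifs with hd
    · subst hd
      exact Submodule.projection_apply_left hc.symm ⟨_, v, rfl⟩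
    · rw [map_zero, LinearMap.zero_apply]
      refine (Submodule.projection_apply_eq_zero_iff hc.symm).2 (hle ?_)
      exact (le_iSup₂ (f := fun j (_ : j ≠ γ) => LinearMap.range (B j).mulVecLin) δ hd) ⟨v, rfl⟩
  choose E hE using key
  exact ⟨E, hE⟩

theorem kronecker_sum_apply {m n p : ℕ} (x : Fin p → EuclideanSpace ℂ (Fin m))
    (B : Fin p → Matrix (Fin n) (Fin n) ℂ) (i j : Fin m) (k l : Fin n) :
    (∑ γ, proj (x γ) ⊗ₖ B γ) (i, k) (j, l) = (∑ γ, proj (x γ) i j • B γ) k l := by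
  simp [Matrix.sum_apply]

theorem trace_proj {m : ℕ} {x : EuclideanSpace ℂ (Fin m)} (hx : ‖x‖ = 1) :
    (proj x).trace = 1 := by
  have h := EuclideanSpace.norm_sq_eq x
  rw [hx] at h
  simp only [Matrix.trace, Matrix.diag_apply, proj, Matrix.of_apply]
  have : ∀ i, x i * star (x i) = ((‖x i‖ ^ 2 : ℝ) : ℂ) := fun i => by
    simpa using Complex.mul_conj' (x i)
  simp_rw [this]
  rw [← Complex.ofReal_sum, ← h]
  simp

theorem marginalB_sum_proj_kronecker {m n : ℕ} {ι : Type*} [Fintype ι]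
    {x : ι → EuclideanSpace ℂ (Fin m)} (hx : ∀ i, ‖x i‖ = 1)
    (B : ι → Matrix (Fin n) (Fin n) ℂ) :
    marginalB (∑ i, proj (x i) ⊗ₖ B i) = ∑ i, B i := by
  have h : marginalB (∑ i, proj (x i) ⊗ₖ B i) = ∑ i, marginalB (proj (x i) ⊗ₖ B i) := by
    ext k l
    simp only [marginalB, Matrix.of_apply, Matrix.sum_apply]
    exact Finset.sum_comm
  simp [h, marginalB_kronecker, trace_proj (hx _)]

/-- Any two decompositions are related by matching: each term of the first occurs in the second. -/
theorem IsDecomposition.exists_match {m n p q : ℕ}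
    {T : Matrix (Fin m × Fin n) (Fin m × Fin n) ℂ}
    {x : Fin p → EuclideanSpace ℂ (Fin m)} {B : Fin p → Matrix (Fin n) (Fin n) ℂ}
    {y : Fin q → EuclideanSpace ℂ (Fin m)} {C : Fin q → Matrix (Fin n) (Fin n) ℂ}
    (hB : IsDecomposition T x B) (hC : IsDecomposition T y C) (γ : Fin p) :
    ∃ δ, proj (x γ) = proj (y δ) ∧ B γ = C δ := by
  obtain ⟨E, hE⟩ := exists_mul_eq_ite hB.independent
  obtain ⟨F, hF⟩ := exists_mul_eq_ite hC.independent
  have hF' : ∀ δ δ', C δ' * (F δ).conjTranspose = if δ' = δ then C δ' else 0 := fun δ δ' => by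
    have := congrArg Matrix.conjTranspose (hF δ δ')
    rw [Matrix.conjTranspose_mul, (hC.posSemidef δ').1.eq] at this
    rw [this]
    split_ifs
    · exact (hC.posSemidef δ').1.eq
    · simp
  have hS : ∑ γ, B γ = ∑ δ, C δ := by
    rw [← marginalB_sum_proj_kronecker hB.norm_eq_one B, ← hB.eq_sum, hC.eq_sum,
      marginalB_sum_proj_kronecker hC.norm_eq_one C]
  have hEC : ∀ γ δ, B γ * (F δ).conjTranspose = E γ * C δ := fun γ δ => by
    have h := congrArg (fun M => E γ * M * (F δ).conjTranspose) hS
    simpa [Finset.mul_sum, hE, Finset.sum_mul, hF', mul_assoc] using h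
  have hzero : ∀ γ δ, proj (x γ) ≠ proj (y δ) → E γ * C δ = 0 := fun γ δ hne => by
    by_contra h0
    apply hne
    ext i j
    -- Compressing the `(i, j)` block of `T` leaves one term on each side: the same matrix `E γ * C
    -- δ`, weighted by the two projection entries.
    have hQ : ∑ γ, proj (x γ) i j • B γ = ∑ δ, proj (y δ) i j • C δ := by
      ext k l
      rw [← kronecker_sum_apply, ← kronecker_sum_apply, ← hB.eq_sum, ← hC.eq_sum]
    have h := congrArg (fun M => E γ * M * (F δ).conjTranspose) hQ
    have h' : proj (x γ) i j • (E γ * C δ) = proj (y δ) i j • (E γ * C δ) := by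
      rw [← hEC]
      simpa [Finset.mul_sum, hE, Finset.sum_mul, hF', mul_assoc, hEC] using h
    exact smul_left_injective ℂ h0 h'
  have hBsum : B γ = ∑ δ, E γ * C δ := by
    rw [← Finset.mul_sum, ← hS, Finset.mul_sum]
    simp [hE]
  obtain ⟨δ, -, hδ⟩ := Finset.exists_ne_zero_of_sum_ne_zero (hBsum ▸ hB.ne_zero γ)
  have hp : proj (x γ) = proj (y δ) := by
    by_contra hne
    exact hδ (hzero γ δ hne)
  refine ⟨δ, hp, ?_⟩
  have h1 : B γ = E γ * C δ := by
    rw [hBsum]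
    refine Finset.sum_eq_single δ (fun d _ hd => hzero γ d fun h => ?_) (by simp)
    exact hC.proj_distinct d δ hd (h.symm.trans hp)
  have h2 : C δ = B γ * (F δ).conjTranspose := by
    have : C δ = ∑ g, B g * (F δ).conjTranspose := by
      rw [← Finset.sum_mul, hS, Finset.sum_mul]
      simp [hF']
    rw [this]
    refine Finset.sum_eq_single γ (fun g _ hg => ?_) (by simp)
    rw [hEC]
    exact hzero g δ fun h => hB.proj_distinct g γ hg (h.trans hp.symm)
  rw [h2, hEC, h1]

theorem IsDecomposition.unique {m n p q : ℕ}
    {T : Matrix (Fin m × Fin n) (Fin m × Fin n) ℂ}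
    {x : Fin p → EuclideanSpace ℂ (Fin m)} {B : Fin p → Matrix (Fin n) (Fin n) ℂ}
    {y : Fin q → EuclideanSpace ℂ (Fin m)} {C : Fin q → Matrix (Fin n) (Fin n) ℂ}
    (hB : IsDecomposition T x B) (hC : IsDecomposition T y C) :
    ∃ σ : Fin p ≃ Fin q, ∀ γ, proj (x γ) = proj (y (σ γ)) ∧ B γ = C (σ γ) := by
  choose f hf using hB.exists_match hC
  choose g hg using hC.exists_match hB
  have inj : ∀ a b, proj (x a) = proj (x b) → a = b := fun a b h => by
    by_contra hab
    exact hB.proj_distinct a b hab h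
  have inj' : ∀ a b, proj (y a) = proj (y b) → a = b := fun a b h => by
    by_contra hab
    exact hC.proj_distinct a b hab h
  exact ⟨⟨f, g, fun a => inj _ _ (((hf a).1.trans (hg (f a)).1).symm),
    fun b => inj' _ _ (((hg b).1.trans (hf (g b)).1).symm)⟩, hf⟩

/-! ### Existence -/

/-- A separable matrix is a sum of product vectors `x_i ⊗ y_i`, with `x_i` a unit vector and
`y_i ≠ 0`. -/
theorem IsSeparable.exists_pure {m n : ℕ} {T : Matrix (Fin m × Fin n) (Fin m × Fin n) ℂ}
    (h : IsSeparable T) :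
    ∃ (ι : Type) (_ : Fintype ι) (x : ι → EuclideanSpace ℂ (Fin m)) (y : ι → Fin n → ℂ),
      (∀ i, ‖x i‖ = 1) ∧ (∀ i, y i ≠ 0) ∧
      T = ∑ i, proj (x i) ⊗ₖ Matrix.vecMulVec (y i) (star (y i)) := by
  classical
  obtain ⟨p, A, B, hA, hB, rfl⟩ := h
  choose a u hu using fun γ => Matrix.posSemidef_iff_eq_sum_vecMulVec.1 (hA γ)
  choose b v hv using fun γ => Matrix.posSemidef_iff_eq_sum_vecMulVec.1 (hB γ)
  let κ := Σ γ : Fin p, Fin (a γ) × Fin (b γ)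
  let U : κ → EuclideanSpace ℂ (Fin m) := fun k => WithLp.toLp 2 (u k.1 k.2.1)
  let V : κ → Fin n → ℂ := fun k => v k.1 k.2.2
  -- Discard zero products and move the norm of the first factor onto the second.
  refine ⟨{k : κ // U k ≠ 0 ∧ V k ≠ 0}, inferInstance, fun k => (‖U k‖⁻¹ : ℂ) • U k,
    fun k => (‖U k‖ : ℂ) • V k, fun k => ?_, fun k => ?_, ?_⟩
  · have := norm_ne_zero_iff.2 k.2.1
    rw [norm_smul]
    simp [this]
  · exact smul_ne_zero (by simpa using k.2.1) k.2.2
  · have h1 : ∀ k : {k : κ // U k ≠ 0 ∧ V k ≠ 0},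
        proj ((‖U k‖⁻¹ : ℂ) • U k) ⊗ₖ
          Matrix.vecMulVec ((‖U k‖ : ℂ) • V k) (star ((‖U k‖ : ℂ) • V k)) =
        proj (U k) ⊗ₖ Matrix.vecMulVec (V k) (star (V k)) := fun k => by
      have hk : (‖U k‖ : ℂ) ≠ 0 := by simpa using k.2.1
      ext ⟨i, j⟩ ⟨i', j'⟩
      simp only [proj, Matrix.kroneckerMap_apply, Matrix.of_apply, Matrix.vecMulVec_apply,
        PiLp.smul_apply, Pi.smul_apply, Pi.star_apply, smul_eq_mul, star_mul', star_inv₀,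
        RCLike.star_def, Complex.conj_ofReal]
      field_simp
    rw [Finset.sum_congr rfl fun k _ => h1 k]
    have h2 : ∑ k : {k : κ // U k ≠ 0 ∧ V k ≠ 0},
        proj (U k) ⊗ₖ Matrix.vecMulVec (V k) (star (V k)) =
        ∑ k, proj (U k) ⊗ₖ Matrix.vecMulVec (V k) (star (V k)) := by
      rw [← Finset.sum_subtype (Finset.univ.filter fun k : κ => U k ≠ 0 ∧ V k ≠ 0) (by simp)
        fun k => proj (U k) ⊗ₖ Matrix.vecMulVec (V k) (star (V k)), Finset.sum_filter_of_ne]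
      intro k _ hk
      refine ⟨fun h => hk ?_, fun h => hk ?_⟩
      · ext ⟨i, j⟩ ⟨i', j'⟩
        simp [h, proj]
      · simp [h]
    rw [h2, Fintype.sum_sigma]
    refine Finset.sum_congr rfl fun γ _ => ?_
    rw [Fintype.sum_prod_type]
    ext ⟨i, j⟩ ⟨i', j'⟩
    rw [hu γ, hv γ]
    simp only [Matrix.kroneckerMap_apply, Matrix.sum_apply, Finset.sum_mul_sum]
    rfl

/-- The matrix with columns `y i`. -/
def columns {k ι : Type*} (y : ι → k → ℂ) : Matrix k ι ℂ := Matrix.of fun a i => y i a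

theorem columns_mulVec {k ι : Type*} [Fintype ι] (y : ι → k → ℂ) (c : ι → ℂ) :
    (columns y).mulVec c = ∑ i, c i • y i := by
  ext a
  simp [columns, Matrix.mulVec, dotProduct, mul_comm]

theorem columns_mul_conjTranspose {k ι : Type*} [Fintype ι] (y : ι → k → ℂ) :
    columns y * (columns y).conjTranspose = ∑ i, Matrix.vecMulVec (y i) (star (y i)) := by
  ext a b
  simp [columns, Matrix.mul_apply, Matrix.sum_apply, Matrix.vecMulVec_apply]

/-- If the columns `x_i ⊗ y_i` and the columns `y_i` span spaces of the same dimension, then the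
linear relations among the `y_i` are stable under the multipliers `x_i(j) / φ(x_i)`. -/
theorem sum_coord_div_smul_eq_zero {m n : ℕ} {ι : Type*} [Fintype ι]
    {x : ι → EuclideanSpace ℂ (Fin m)} {y : ι → Fin n → ℂ}
    {φ : Module.Dual ℂ (EuclideanSpace ℂ (Fin m))} (hφ : ∀ i, φ (x i) ≠ 0)
    (hr : (columns fun i (a : Fin m × Fin n) => x i a.1 * y i a.2).rank = (columns y).rank)
    {c : ι → ℂ} (hc : ∑ i, c i • y i = 0) (j : Fin m) :
    ∑ i, (x i j / φ (x i) * c i) • y i = 0 := by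
  classical
  set Z := columns fun i (a : Fin m × Fin n) => x i a.1 * y i a.2 with hZ
  -- The columns of `Y` are the images of those of `Z` under `φ ⊗ 1`.
  set Y := columns y * Matrix.diagonal fun i => φ (x i) with hY
  have hYr : Y.rank = (columns y).rank := by
    refine Matrix.rank_mul_eq_left_of_isUnit_det _ _ ?_
    rw [Matrix.det_diagonal, isUnit_iff_ne_zero]
    exact Finset.prod_ne_zero_iff.2 fun i _ => hφ i
  have hYv : ∀ d, Y.mulVec d = ∑ i, (φ (x i) * d i) • y i := fun d => by
    rw [hY, ← Matrix.mulVec_mulVec, columns_mulVec]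
    simp [Matrix.mulVec_diagonal]
  have hle : LinearMap.ker Z.mulVecLin ≤ LinearMap.ker Y.mulVecLin := by
    intro d hd
    rw [LinearMap.mem_ker, Matrix.mulVecLin_apply, columns_mulVec] at hd
    rw [LinearMap.mem_ker, Matrix.mulVecLin_apply, hYv]
    ext k
    have h0 : ∑ i, (d i * y i k) • x i = 0 := by
      ext j
      have := congrFun hd (j, k)
      simp only [Finset.sum_apply, Pi.smul_apply, smul_eq_mul, Pi.zero_apply] at this
      simp only [WithLp.ofLp_sum, WithLp.ofLp_smul, Finset.sum_apply, Pi.smul_apply, smul_eq_mul,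
        WithLp.ofLp_zero, Pi.zero_apply]
      rw [← this]
      exact Finset.sum_congr rfl fun i _ => by ring
    have := congrArg φ h0
    rw [map_sum, map_zero] at this
    simp only [map_smul, smul_eq_mul] at this
    simp only [Finset.sum_apply, Pi.smul_apply, smul_eq_mul, Pi.zero_apply]
    rw [← this]
    exact Finset.sum_congr rfl fun i _ => by ring
  have heq : LinearMap.ker Z.mulVecLin = LinearMap.ker Y.mulVecLin := by
    refine Submodule.eq_of_le_of_finrank_eq hle ?_
    have h1 := Z.mulVecLin.finrank_range_add_finrank_ker
    have h2 := Y.mulVecLin.finrank_range_add_finrank_ker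
    have h3 : Z.rank = Y.rank := hr.trans hYr.symm
    rw [Matrix.rank, Matrix.rank] at h3
    omega
  have hmem : (fun i => c i / φ (x i)) ∈ LinearMap.ker Z.mulVecLin := by
    rw [heq, LinearMap.mem_ker, Matrix.mulVecLin_apply, hYv, ← hc]
    exact Finset.sum_congr rfl fun i _ => by rw [mul_div_cancel₀ _ (hφ i)]
  rw [LinearMap.mem_ker, Matrix.mulVecLin_apply, columns_mulVec] at hmem
  ext k
  have := congrFun hmem (j, k)
  simp only [Finset.sum_apply, Pi.smul_apply, smul_eq_mul, Pi.zero_apply] at this ⊢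
  rw [← this]
  exact Finset.sum_congr rfl fun i _ => by ring

/-- If the linear relations among the `y_i` are stable under all multipliers `u_i(j)`, then they
restrict to the fibres of `u`. -/
theorem sum_fiber_smul_eq_zero {ι J V : Type*} [Fintype ι] [AddCommGroup V] [Module ℂ V]
    {u : ι → J → ℂ} {y : ι → V}
    (hst : ∀ c : ι → ℂ, ∑ i, c i • y i = 0 → ∀ j, ∑ i, (u i j * c i) • y i = 0)
    {c : ι → ℂ} (hc : ∑ i, c i • y i = 0) (v : J → ℂ) [DecidablePred fun i => u i = v] :
    ∑ i with u i = v, c i • y i = 0 := by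
  let P : (ι → ℂ) → Prop := fun a => ∀ c : ι → ℂ, ∑ i, c i • y i = 0 → ∑ i, (a i * c i) • y i = 0
  have hone : P 1 := fun c hc => by simpa using hc
  have key : ∀ i, ∃ a, P a ∧ (∀ k, u k = v → a k = 1) ∧ (u i ≠ v → a i = 0) := by
    intro i
    by_cases h : u i = v
    · exact ⟨1, hone, fun _ _ => rfl, fun h' => absurd h h'⟩
    · obtain ⟨j, hj⟩ := Function.ne_iff.1 h
      have hj' : v j - u i j ≠ 0 := sub_ne_zero.2 hj.symm
      -- A Lagrange factor: 1 on the fibre of `v`, 0 at `u i`. The product over `i` is the indicator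
      -- of the fibre.
      refine ⟨fun k => (v j - u i j)⁻¹ * (u k j - u i j), fun c hc => ?_, fun k hk => ?_, fun _ => ?_⟩
      · have h1 : ∀ k, ((v j - u i j)⁻¹ * (u k j - u i j) * c k) • y k =
            (v j - u i j)⁻¹ • ((u k j * c k) • y k - u i j • c k • y k) := fun k => by
          module
        rw [Finset.sum_congr rfl fun k _ => h1 k, ← Finset.smul_sum, Finset.sum_sub_distrib,
          hst c hc j, ← Finset.smul_sum, hc]
        simp
      · simp [hk, hj']
      · simp
  choose a hP h1 h0 using key
  have hprod : P (∏ i, a i) := Finset.prod_induction a P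
    (fun f g hf hg c hc => by simpa [mul_assoc] using hf _ (hg c hc)) hone fun i _ => hP i
  have := hprod c hc
  rw [Finset.sum_filter]
  refine Eq.trans ?_ this
  refine Finset.sum_congr rfl fun k _ => ?_
  rw [Finset.prod_apply]
  split_ifs with hk
  · simp [h1 _ k hk]
  · rw [Finset.prod_eq_zero (f := fun i => a i k) (Finset.mem_univ k) (h0 k hk)]
    simp

/-- Unit vectors on one line differ by a phase, which cancels in the affine chart `φ = 1`. -/
theorem proj_eq_iff {m : ℕ} {x y : EuclideanSpace ℂ (Fin m)} (hx : ‖x‖ = 1) (hy : ‖y‖ = 1)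
    {φ : Module.Dual ℂ (EuclideanSpace ℂ (Fin m))} (hφx : φ x ≠ 0) (hφy : φ y ≠ 0) :
    proj x = proj y ↔ (fun j => x j / φ x) = fun j => y j / φ y := by
  constructor
  · intro h
    have h1 : x = (inner ℂ y x) • y := by
      have hx' := LinearMap.congr_fun (toEuclideanLin_proj x hx) x
      have hy' := LinearMap.congr_fun (toEuclideanLin_proj y hy) x
      rw [ContinuousLinearMap.coe_coe, Submodule.starProjection_unit_singleton ℂ hx] at hx'
      rw [ContinuousLinearMap.coe_coe, Submodule.starProjection_unit_singleton ℂ hy, ← h, hx'] at hy'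
      rw [← hy', inner_self_eq_norm_sq_to_K, hx]
      simp
    generalize inner ℂ y x = r at h1
    subst h1
    have hr : r ≠ 0 := fun h => hφx (by simp [h])
    ext j
    simp only [map_smul, PiLp.smul_apply, smul_eq_mul]
    rw [mul_div_mul_left _ _ hr]
  · intro h
    have h1 : x = (φ x / φ y) • y := by
      ext j
      have := congrFun h j
      simp only [PiLp.smul_apply, smul_eq_mul]
      field_simp at this ⊢
      linear_combination this
    generalize φ x / φ y = r at h1
    subst h1
    rw [norm_smul, hy, mul_one] at hx
    ext i j
    have hr : r * (starRingEnd ℂ) r = 1 := by simp [Complex.mul_conj', hx]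
    simp only [proj, Matrix.of_apply, PiLp.smul_apply, smul_eq_mul, star_mul', RCLike.star_def]
    linear_combination (y i * (starRingEnd ℂ) (y j)) * hr

/-- If the linear relations among the `y_i` restrict to the fibres of `g`, then the sums of
`y_i y_i*` over the fibres have independent images. -/
theorem iSupIndep_range_sum_fiber {n ι G : Type*} [Fintype n] [Fintype ι] [DecidableEq G]
    {g : ι → G} {y : ι → n → ℂ}
    (h : ∀ c : ι → ℂ, ∑ i, c i • y i = 0 → ∀ γ, ∑ i with g i = γ, c i • y i = 0) :
    iSupIndep fun γ => LinearMap.range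
      (∑ i with g i = γ, Matrix.vecMulVec (y i) (star (y i))).mulVecLin := by
  rw [iSupIndep_iff_finsetSum_eq_zero_imp_eq_zero]
  intro s w hw hsum
  choose! v hv using fun γ (hγ : γ ∈ s) => LinearMap.mem_range.1 (hw γ hγ)
  -- `y y*` applied to `v` is `(y* v) y`, so each `w γ` is a combination of the `y i` in its fibre.
  let c : ι → ℂ := fun i => if g i ∈ s then star (y i) ⬝ᵥ v (g i) else 0
  have hfib : ∀ γ ∈ s, ∑ i with g i = γ, c i • y i = w γ := fun γ hγ => by
    rw [← hv γ hγ, Matrix.mulVecLin_apply, Matrix.sum_mulVec]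
    refine Finset.sum_congr rfl fun i hi => ?_
    obtain rfl := (Finset.mem_filter.1 hi).2
    simp [c, hγ, Matrix.vecMulVec_mulVec]
  have hc : ∑ i, c i • y i = 0 := by
    rw [← hsum, ← Finset.sum_congr rfl hfib,
      Finset.sum_fiberwise_eq_sum_filter, Finset.sum_filter_of_ne]
    intro i _ hi
    by_contra hs
    simp [c, hs] at hi
  intro γ hγ
  rw [← hfib γ hγ, h c hc γ]

theorem IsSeparable.exists_isDecomposition {m n : ℕ}
    {T : Matrix (Fin m × Fin n) (Fin m × Fin n) ℂ} (h : IsSeparable T) (hr : MarginalRank T) :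
    ∃ (p : ℕ) (x : Fin p → EuclideanSpace ℂ (Fin m)) (B : Fin p → Matrix (Fin n) (Fin n) ℂ),
      IsDecomposition T x B := by
  classical
  obtain ⟨ι, _, x, y, hx, hy, rfl⟩ := h.exists_pure
  have hrank : (columns fun i (a : Fin m × Fin n) => x i a.1 * y i a.2).rank =
      (columns y).rank := by
    rw [MarginalRank, marginalB_sum_proj_kronecker hx, ← columns_mul_conjTranspose,
      Matrix.rank_self_mul_conjTranspose] at hr
    rw [← hr, ← Matrix.rank_self_mul_conjTranspose, columns_mul_conjTranspose]
    congr 1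
    refine Finset.sum_congr rfl fun i _ => ?_
    ext ⟨a, b⟩ ⟨a', b'⟩
    simp only [Matrix.vecMulVec_apply, Matrix.kroneckerMap_apply, proj, Matrix.of_apply,
      Pi.star_apply, star_mul']
    ring
  -- Finitely many nonzero vectors can be avoided by the kernel of one functional, as `ℂ` is
  -- infinite.
  obtain ⟨φ, hφ⟩ := Module.exists_dual_forall_apply_ne_zero (K := ℂ) x fun i h0 => by
    simpa [h0] using hx i
  let f : ι → Set.range fun i => proj (x i) := Set.rangeFactorization fun i => proj (x i)
  let e := Fintype.equivFin (Set.range fun i => proj (x i))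
  let g : ι → Fin _ := fun i => e (f i)
  have hg : ∀ i j, g i = g j ↔ proj (x i) = proj (x j) := fun i j => by
    simp [g, f, Set.rangeFactorization, Subtype.ext_iff]
  have hsurj : Function.Surjective g := e.surjective.comp Set.rangeFactorization_surjective
  obtain ⟨r, hgr⟩ := hsurj.hasRightInverse
  let B := fun γ => ∑ i with g i = γ, Matrix.vecMulVec (y i) (star (y i))
  refine ⟨_, x ∘ r, B, fun γ => hx _, fun γ δ hne he => hne ?_, fun γ => ?_, fun γ hB => ?_, ?_, ?_⟩
  · rw [← hgr γ, ← hgr δ]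
    exact (hg _ _).2 he
  · exact Matrix.posSemidef_sum _ fun i _ => Matrix.posSemidef_vecMulVec_self_star _
  -- Nonnegative traces summing to zero all vanish, but each fibre contains its representative `r
  -- γ`.
  · have htr := congrArg Matrix.trace hB
    rw [Matrix.trace_sum, Matrix.trace_zero, Finset.sum_eq_zero_iff_of_nonneg fun i _ =>
      (Matrix.posSemidef_vecMulVec_self_star (y i)).trace_nonneg] at htr
    have := htr (r γ) (by simp [hgr γ])
    rw [Matrix.trace_vecMulVec, dotProduct_self_star_eq_zero] at this
    exact hy _ this
  · refine iSupIndep_range_sum_fiber fun c hc γ => ?_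
    have := sum_fiber_smul_eq_zero (u := fun i j => x i j / φ (x i)) (y := y)
      (fun c hc => sum_coord_div_smul_eq_zero hφ hrank hc) hc (fun j => x (r γ) j / φ (x (r γ)))
    rw [← this]
    refine Finset.sum_congr (Finset.filter_congr fun i _ => ?_) fun _ _ => rfl
    rw [← proj_eq_iff (hx i) (hx _) (hφ i) (hφ _), ← hg, hgr γ]
  · rw [← Finset.sum_fiberwise _ g]
    refine Finset.sum_congr rfl fun γ _ => ?_
    have : ∀ i ∈ Finset.univ.filter (g · = γ), proj (x i) ⊗ₖ Matrix.vecMulVec (y i) (star (y i)) =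
        proj (x (r γ)) ⊗ₖ Matrix.vecMulVec (y i) (star (y i)) := fun i hi => by
      rw [(hg i (r γ)).1 (by rw [hgr γ]; exact (Finset.mem_filter.1 hi).2)]
    rw [Finset.sum_congr rfl this]
    ext ⟨a, b⟩ ⟨a', b'⟩
    simp [B, Matrix.sum_apply, Finset.mul_sum]

end SepState

theorem mainTheorem8 (m n : ℕ) (T : Matrix (Fin m × Fin n) (Fin m × Fin n) ℂ)
    (hsep : SepState.IsSeparable T) (hrank : SepState.MarginalRank T) :
    (∃ (p : ℕ) (x : Fin p → EuclideanSpace ℂ (Fin m)) (B : Fin p → Matrix (Fin n) (Fin n) ℂ),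
      SepState.IsDecomposition T x B) ∧
    (∀ (p q : ℕ)
      (x : Fin p → EuclideanSpace ℂ (Fin m)) (B : Fin p → Matrix (Fin n) (Fin n) ℂ)
      (y : Fin q → EuclideanSpace ℂ (Fin m)) (C : Fin q → Matrix (Fin n) (Fin n) ℂ),
      SepState.IsDecomposition T x B → SepState.IsDecomposition T y C →
      ∃ σ : Fin p ≃ Fin q, ∀ γ,
        SepState.proj (x γ) = SepState.proj (y (σ γ)) ∧ B γ = C (σ γ)) :=
  ⟨hsep.exists_isDecomposition hrank, fun _ _ _ _ _ _ hB hC => hB.unique hC⟩
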